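/- All algebras are associative, not necessarily commutative and not necessarily unital. A $K$-algebra $R$ is locally nilpotent if every finitely generated subalgebra $S$ of $R$ is nilpotent, i.e. $S^n=0$ for some $n\ge 1$. A derivation on $R$ is a $K$-linear map $D:R\to R$ with $D(ab)=D(a)b+aD(b)$ for all $a,b\in R$. The differential polynomial ring $R[X;D]$ consists of all polynomials $a_nX^n+\dots+a_1X+a_0$ with $a_i\in R$, with coefficientwise addition and with the multiplication determined by $X^iX^j=X^{i+j}$ and $Xa=aX+D(a)$ for $a\in R$. A ring $S$ is Jacobson radical if it equals its Jacobson radical, i.e. if every element of $S$ is quasiregular. **Theorem.** Let $K$ be a field. Then there exist a locally nilpotent $K$-algebra $R$ and a derivation $D$ on $R$ such that $R[X;D]$ is not a Jacobson radical ring. -/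

import Mathlib

universe u v

noncomputable section

/-- A `K`-linear derivation `D` of a (not necessarily unital or commutative) `K`-algebra `R`:
`D (a * b) = D a * b + a * D b`. -/
structure NUDerivation (K : Type u) (R : Type v) [Field K] [NonUnitalRing R] [Module K R]
    extends R →ₗ[K] R where
  leibniz' : ∀ a b : R, toFun (a * b) = toFun a * b + a * toFun b

/-- A non-unital ring `R` is nilpotent if, for some `n`, all products
`a * a₁ * ⋯ * aₙ` of `n + 1` elements of `R` vanish. -/
def IsNilpotentAlgebra (R : Type v) [NonUnitalRing R] : Prop :=
  ∃ n : ℕ, ∀ (a : R) (l : List R), l.length = n → l.foldl (fun x y => x * y) a = 0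

/-- `R` is locally nilpotent if every finitely generated (non-unital) subalgebra of `R` is
nilpotent. -/
def IsLocallyNilpotentAlgebra (K : Type u) (R : Type v) [Field K] [NonUnitalRing R]
    [Module K R] [IsScalarTower K R R] [SMulCommClass K R R] : Prop :=
  ∀ s : Finset R, IsNilpotentAlgebra (NonUnitalAlgebra.adjoin K (s : Set R))

/-- A (not necessarily unital) ring is Jacobson radical, i.e. equal to its Jacobson radical, if
all its elements are quasiregular. -/
def IsJacobsonRadicalRing (S : Type v) [NonUnitalRing S] : Prop :=
  ∀ x : S, IsQuasiregular x

/-- This is the same as `S` being contained in the Jacobson radical of the ring `S¹` obtained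
from `S` by adjoining a unity. -/
theorem isJacobsonRadicalRing_iff (S : Type v) [NonUnitalRing S] :
    IsJacobsonRadicalRing S ↔
      ∀ x : S, (x : Unitization ℤ S) ∈ Ring.jacobson (Unitization ℤ S) := by
  have unit_iff : ∀ x : S, IsQuasiregular x ↔ IsUnit (1 + x : Unitization ℤ S) :=
    fun x => isQuasiregular_iff_isUnit' ℤ
  simp only [← Ideal.jacobson_bot, Ideal.mem_jacobson_iff, Ideal.mem_bot]
  constructor
  · intro h x y
    obtain ⟨w, hw⟩ : ∃ w : S, y * (x : Unitization ℤ S) = w :=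
      ⟨(y * (x : Unitization ℤ S)).toProd.2, by ext <;> simp [-Unitization.snd_mul]⟩
    obtain ⟨z, hz⟩ := ((unit_iff w).1 (h w)).exists_left_inv
    exact ⟨z, by rw [mul_assoc, hw, ← hz]; noncomm_ring⟩
  · intro h
    have key : ∀ x : S, ∃ w : S, (1 + w : Unitization ℤ S) * (1 + x) = 1 := by
      intro x
      obtain ⟨z, hz⟩ := h x 1
      have h1 : z * (1 + x) = 1 := by
        rw [← sub_eq_zero, ← hz]; noncomm_ring
      have h2 : z.toProd.1 = 1 := by simpa using congrArg (fun u => u.toProd.1) h1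
      have h3 : z = 1 + (z.toProd.2 : Unitization ℤ S) := by ext <;> simp [h2]
      exact ⟨z.toProd.2, by rw [← h3]; exact h1⟩
    intro x
    obtain ⟨w, hw⟩ := key x
    obtain ⟨t, ht⟩ := key w
    have e : (1 + t : Unitization ℤ S) = 1 + x := left_inv_eq_right_inv ht hw
    exact (unit_iff x).2 (isUnit_iff_exists.2 ⟨1 + w, by rw [← e, ht], hw⟩)

/-- The differential polynomial ring `R[X; D]`: the element `f` stands for the polynomial
`∑ i, (f i) X ^ i`, with coefficients in `R` written on the left of the powers of `X`. -/
def DiffPoly {K : Type u} {R : Type v} [Field K] [NonUnitalRing R] [Module K R]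
    (_D : NUDerivation K R) : Type v := ℕ →₀ R

namespace DiffPoly

variable {K : Type u} {R : Type v} [Field K] [NonUnitalRing R] [Module K R]
  (D : NUDerivation K R)

instance : AddCommGroup (DiffPoly D) := inferInstanceAs (AddCommGroup (ℕ →₀ R))

/-- The monomial `a X ^ i`. -/
def monomial (i : ℕ) : R →+ DiffPoly D := Finsupp.singleAddHom i

/-- Left multiplication by a constant `a`: `∑ b_j X ^ j ↦ ∑ (a b_j) X ^ j`. -/
def constMul (a : R) : DiffPoly D →+ DiffPoly D :=
  Finsupp.mapRange.addMonoidHom (AddMonoidHom.mulLeft a)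

/-- Left multiplication by `X`, according to the rule `X b = b X + D b`:
`∑ b_j X ^ j ↦ ∑ (b_j X ^ (j + 1) + (D b_j) X ^ j)`. -/
def mulX : DiffPoly D →+ DiffPoly D :=
  Finsupp.mapDomain.addMonoidHom (fun j => j + 1) +
    Finsupp.mapRange.addMonoidHom D.toLinearMap.toAddMonoidHom

/-- The product `(∑ a_i X ^ i) * q = ∑ a_i (X (X (⋯ (X q))))`, with `i` factors `X`. -/
instance : Mul (DiffPoly D) :=
  ⟨fun p q => Finsupp.sum (p : ℕ →₀ R) fun i a => constMul D a ((mulX D)^[i] q)⟩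

theorem hom_ext {G : Type*} [AddCommGroup G] {f g : DiffPoly D →+ G}
    (h : ∀ i a, f (monomial D i a) = g (monomial D i a)) : f = g :=
  Finsupp.addHom_ext h

theorem constMul_monomial (a b : R) (j : ℕ) :
    constMul D a (monomial D j b) = monomial D j (a * b) :=
  Finsupp.mapRange_single (hf := mul_zero a)

theorem mulX_monomial (b : R) (j : ℕ) :
    mulX D (monomial D j b) = monomial D (j + 1) b + monomial D j (D.toLinearMap b) := by
  exact congrArg₂ (· + ·) Finsupp.mapDomain_single
    (Finsupp.mapRange_single (hf := map_zero D.toLinearMap))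

theorem mulX_iterate_add (i : ℕ) (p q : DiffPoly D) :
    (mulX D)^[i] (p + q) = (mulX D)^[i] p + (mulX D)^[i] q :=
  iterate_map_add (mulX D) i p q

theorem constMul_zero_left (p : DiffPoly D) : constMul D 0 p = 0 := by
  refine DFunLike.congr_fun (f := constMul D 0) (g := 0) (hom_ext D fun i a => ?_) p
  simp [constMul_monomial]

theorem constMul_add_left (a b : R) (p : DiffPoly D) :
    constMul D (a + b) p = constMul D a p + constMul D b p := by
  refine DFunLike.congr_fun (f := constMul D (a + b)) (g := constMul D a + constMul D b)
    (hom_ext D fun i c => ?_) p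
  simp [constMul_monomial, add_mul]

theorem constMul_constMul (a b : R) (p : DiffPoly D) :
    constMul D a (constMul D b p) = constMul D (a * b) p := by
  refine DFunLike.congr_fun (f := (constMul D a).comp (constMul D b)) (g := constMul D (a * b))
    (hom_ext D fun i c => ?_) p
  simp [constMul_monomial, mul_assoc]

theorem mulX_constMul (a : R) (p : DiffPoly D) :
    mulX D (constMul D a p) = constMul D a (mulX D p) + constMul D (D.toLinearMap a) p := by
  refine DFunLike.congr_fun (f := (mulX D).comp (constMul D a))
    (g := (constMul D a).comp (mulX D) + constMul D (D.toLinearMap a)) (hom_ext D fun i c => ?_) p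
  have h : D.toLinearMap (a * c) = D.toLinearMap a * c + a * D.toLinearMap c := D.leibniz' a c
  simp only [AddMonoidHom.comp_apply, AddMonoidHom.add_apply, constMul_monomial, mulX_monomial,
    map_add, h]
  abel

theorem monomial_mul (i : ℕ) (a : R) (q : DiffPoly D) :
    monomial D i a * q = constMul D a ((mulX D)^[i] q) :=
  Finsupp.sum_single_index (constMul_zero_left D _)

protected theorem add_mul' (p q r : DiffPoly D) : (p + q) * r = p * r + q * r :=
  Finsupp.sum_add_index' (fun _ => constMul_zero_left D _) (fun _ _ _ => constMul_add_left D _ _ _)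

protected theorem mul_add' (p q r : DiffPoly D) : p * (q + r) = p * q + p * r := by
  change Finsupp.sum _ _ = Finsupp.sum _ _ + Finsupp.sum _ _
  simp only [mulX_iterate_add, map_add]
  exact Finsupp.sum_add

instance : NonUnitalNonAssocRing (DiffPoly D) where
  left_distrib := DiffPoly.mul_add' D
  right_distrib := DiffPoly.add_mul' D
  zero_mul p := by simpa using DiffPoly.add_mul' D 0 0 p
  mul_zero p := by simpa using DiffPoly.mul_add' D p 0 0

theorem constMul_mul (a : R) (p q : DiffPoly D) :
    constMul D a p * q = constMul D a (p * q) := by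
  refine DFunLike.congr_fun (f := (AddMonoidHom.mulRight q).comp (constMul D a))
    (g := (constMul D a).comp (AddMonoidHom.mulRight q)) (hom_ext D fun i c => ?_) p
  simp [constMul_monomial, monomial_mul, constMul_constMul]

theorem mulX_mul (p q : DiffPoly D) : mulX D p * q = mulX D (p * q) := by
  refine DFunLike.congr_fun (f := (AddMonoidHom.mulRight q).comp (mulX D))
    (g := (mulX D).comp (AddMonoidHom.mulRight q)) (hom_ext D fun i c => ?_) p
  simp [mulX_monomial, monomial_mul, add_mul, mulX_constMul, Function.iterate_succ_apply']

protected theorem mul_assoc' (p q r : DiffPoly D) : p * q * r = p * (q * r) := by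
  have iter : ∀ (i : ℕ) (s : DiffPoly D), (mulX D)^[i] s * r = (mulX D)^[i] (s * r) := by
    intro i
    induction i with
    | zero => intro s; rfl
    | succ i ih => intro s; simp only [Function.iterate_succ_apply, ih, mulX_mul]
  refine DFunLike.congr_fun (f := (AddMonoidHom.mulRight r).comp (AddMonoidHom.mulRight q))
    (g := AddMonoidHom.mulRight (q * r)) (hom_ext D fun i c => ?_) p
  simp [monomial_mul, constMul_mul, iter]

instance : NonUnitalRing (DiffPoly D) where
  mul_assoc := DiffPoly.mul_assoc' D

end DiffPoly

end

/-! Let `x`, `a` be endomorphisms of a space `V`, let `R` be the algebra generated by the iterated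
commutators of `a` with `x`, and let `D = [x, -]`. Evaluating the polynomial variable at `x` sends
`aX + D(a)` to `x * a`; a quasi-inverse of this element would make `1 + x * a` surjective. So it
suffices to find `x`, `a` with `R` locally nilpotent and `1 + x * a` not surjective.

`V` consists of polynomials in `T 0, T 1, …` placed at discrete times. `x = X` multiplies by the sum
of the active variables; `a = step` advances time by one. The variable `T r` has period `(r + 1)!`:
at each period end `step` keeps only the monomials of exponent exactly `r` in it and erases that
exponent.

Local nilpotency (`killed_genSet_eq_top`): take `r = 2N + 1` and commutators of order at most `N`.
Leaving a multiple of the period, where `T r` has degree 0, a generator raises the degree in `T r`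
to at most `N`. Inside the period the degree does not grow, because generators commute with `T r`
there (`gen_level_of_active`). The generator that ends the period can add at most `N` more before
`step`, and `2N < r`, so the result vanishes.

Non-surjectivity (`not_exists_X_step`): the lexicographically leading exponents of `(X * step) ^ k`
on the initial vector are the factorial-base digits of `k`, since the operator acts on them as an
odometer. So no power kills this vector, and the forced solution `∑ (-1) ^ k (X * step) ^ k e` has
infinite support. -/

open scoped Nat

noncomputable section

/-! ### Nilpotency from an ascending chain of annihilated subspaces -/

section Killed

variable {K : Type u} [Field K] {V : Type u} [AddCommGroup V] [Module K V]

/-- The vectors that are annihilated by all products of `n` elements of `G`. -/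
def killed (G : Set (Module.End K V)) : ℕ → Submodule K V
  | 0 => ⊥
  | n + 1 => ⨅ b ∈ G, (killed G n).comap b

theorem mem_killed_succ {G : Set (Module.End K V)} {n : ℕ} {w : V} :
    w ∈ killed G (n + 1) ↔ ∀ b ∈ G, b w ∈ killed G n := by
  simp [killed]

theorem killed_mono (G : Set (Module.End K V)) : Monotone (killed G) := by
  refine monotone_nat_of_le_succ fun n => ?_
  induction n with
  | zero => exact bot_le
  | succ n ih =>
    intro w hw
    rw [mem_killed_succ] at hw ⊢
    exact fun b hb => ih (hw b hb)

theorem apply_mem_killed_of_mem_adjoin {G : Set (Module.End K V)} {b : Module.End K V}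
    (hb : b ∈ NonUnitalAlgebra.adjoin K G) :
    ∀ n, ∀ w ∈ killed G (n + 1), b w ∈ killed G n := by
  induction hb using NonUnitalAlgebra.adjoin_induction with
  | mem b hb => exact fun n w hw => mem_killed_succ.1 hw b hb
  | add b c _ _ ihb ihc => exact fun n w hw => add_mem (ihb n w hw) (ihc n w hw)
  | zero => exact fun n w _ => zero_mem _
  | mul b c _ _ ihb ihc =>
    exact fun n w hw => ihb n _ (ihc (n + 1) w (killed_mono G (Nat.le_succ _) hw))
  | smul r b _ ihb => exact fun n w hw => Submodule.smul_mem _ r (ihb n w hw)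

theorem isNilpotentAlgebra_of_killed_eq_top {A : Type v} [NonUnitalRing A]
    (ρ : A → Module.End K V) (hmul : ∀ a b, ρ (a * b) = ρ a * ρ b)
    (hinj : ∀ a, ρ a = 0 → a = 0) {G : Set (Module.End K V)}
    (hG : ∀ a, ρ a ∈ NonUnitalAlgebra.adjoin K G) {M : ℕ} (hM : killed G M = ⊤) :
    IsNilpotentAlgebra A := by
  -- Here `t` counts the factors already absorbed into `a`; each further factor lowers the index in
  -- the chain by one more.
  have key : ∀ (l : List A) (a : A) (t : ℕ),
      (∀ n, ∀ w ∈ killed G (n + t), ρ a w ∈ killed G n) →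
      ∀ n, ∀ w ∈ killed G (n + (t + l.length)),
        ρ (l.foldl (fun x y => x * y) a) w ∈ killed G n := by
    intro l
    induction l with
    | nil => exact fun a t h => h
    | cons b l ih =>
      intro a t h n w hw
      refine ih (a * b) (t + 1) (fun n w hw => ?_) n w ?_
      · rw [hmul]
        exact h n _ (apply_mem_killed_of_mem_adjoin (hG b) (n + t) w hw)
      · rwa [List.length_cons, add_comm l.length, ← add_assoc t] at hw
  refine ⟨M, fun a l hl => hinj _ (LinearMap.ext fun w => ?_)⟩
  have h := key l a 1 (apply_mem_killed_of_mem_adjoin (hG a)) 0 w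
    (killed_mono G (show M ≤ 0 + (1 + l.length) by omega) (hM ▸ Submodule.mem_top))
  exact (Submodule.mem_bot K).1 h

end Killed

/-! ### Evaluation of differential polynomials -/

namespace DiffPoly

variable {K : Type u} {R : Type v} [Field K] [NonUnitalRing R] [Module K R]
  (D : NUDerivation K R)

/-- Evaluation of a differential polynomial at `x`, where `ρ` gives the values of the
coefficients. -/
def eval {E : Type*} [Ring E] (ρ : R →+ E) (x : E) : DiffPoly D →+ E :=
  Finsupp.liftAddHom fun i => (AddMonoidHom.mulRight (x ^ i)).comp ρ

variable {E : Type*} [Ring E] (ρ : R →+ E) (x : E)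

theorem eval_monomial (i : ℕ) (b : R) : eval D ρ x (monomial D i b) = ρ b * x ^ i := by
  exact (Finsupp.liftAddHom_apply_single _ i b)

variable (hmul : ∀ b c, ρ (b * c) = ρ b * ρ c)
  (hD : ∀ b, ρ (D.toLinearMap b) = x * ρ b - ρ b * x)

include hmul in
theorem eval_constMul (b : R) (p : DiffPoly D) :
    eval D ρ x (constMul D b p) = ρ b * eval D ρ x p := by
  refine DFunLike.congr_fun (f := (eval D ρ x).comp (constMul D b))
    (g := (AddMonoidHom.mulLeft (ρ b)).comp (eval D ρ x)) (hom_ext D fun i c => ?_) p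
  simp [constMul_monomial, eval_monomial, hmul, mul_assoc]

include hD in
theorem eval_mulX (p : DiffPoly D) : eval D ρ x (mulX D p) = x * eval D ρ x p := by
  refine DFunLike.congr_fun (f := (eval D ρ x).comp (mulX D))
    (g := (AddMonoidHom.mulLeft x).comp (eval D ρ x)) (hom_ext D fun i c => ?_) p
  simp only [AddMonoidHom.comp_apply, mulX_monomial, map_add, eval_monomial, hD,
    AddMonoidHom.coe_mulLeft, pow_succ']
  noncomm_ring

include hmul hD in
-- Multiplicativity for a monomial left factor suffices, as the element used later is a sum of two
-- monomials.
theorem eval_monomial_mul (i : ℕ) (b : R) (p : DiffPoly D) :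
    eval D ρ x (monomial D i b * p) = ρ b * x ^ i * eval D ρ x p := by
  rw [monomial_mul, eval_constMul D ρ x hmul, mul_assoc]
  congr 1
  induction i with
  | zero => simp
  | succ i ih =>
    rw [Function.iterate_succ_apply', eval_mulX D ρ x hD, ih, pow_succ', mul_assoc]

end DiffPoly

/-! ### The algebra generated by iterated commutators, and its derivation -/

section Commutator

variable {K : Type u} [Field K] {V : Type u} [AddCommGroup V] [Module K V]

/-- The iterated commutators `[x, [x, …, [x, a]]]`. -/
def iteratedCommutator (x a : Module.End K V) : ℕ → Module.End K V
  | 0 => a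
  | i + 1 => x * iteratedCommutator x a i - iteratedCommutator x a i * x

variable (x a : Module.End K V)

/-- The algebra generated by all iterated commutators. -/
def commutatorAlgebra : NonUnitalSubalgebra K (Module.End K V) :=
  NonUnitalAlgebra.adjoin K (Set.range (iteratedCommutator x a))

variable {x a}

theorem iteratedCommutator_mem (i : ℕ) : iteratedCommutator x a i ∈ commutatorAlgebra x a :=
  NonUnitalAlgebra.subset_adjoin K ⟨i, rfl⟩

theorem exists_mem_adjoin_image_Iic {b : Module.End K V} (hb : b ∈ commutatorAlgebra x a) :
    ∃ N, b ∈ NonUnitalAlgebra.adjoin K (iteratedCommutator x a '' Set.Iic N) := by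
  have mono : ∀ {M N : ℕ}, M ≤ N →
      NonUnitalAlgebra.adjoin K (iteratedCommutator x a '' Set.Iic M) ≤
        NonUnitalAlgebra.adjoin K (iteratedCommutator x a '' Set.Iic N) :=
    fun h => NonUnitalAlgebra.adjoin_mono (Set.image_mono (Set.Iic_subset_Iic.2 h))
  induction hb using NonUnitalAlgebra.adjoin_induction with
  | mem b hb =>
    obtain ⟨i, rfl⟩ := hb
    exact ⟨i, NonUnitalAlgebra.subset_adjoin K ⟨i, Set.mem_Iic.2 le_rfl, rfl⟩⟩
  | add b c _ _ ihb ihc =>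
    obtain ⟨M, hM⟩ := ihb
    obtain ⟨N, hN⟩ := ihc
    exact ⟨max M N, add_mem (mono (le_max_left M N) hM) (mono (le_max_right M N) hN)⟩
  | zero => exact ⟨0, zero_mem _⟩
  | mul b c _ _ ihb ihc =>
    obtain ⟨M, hM⟩ := ihb
    obtain ⟨N, hN⟩ := ihc
    exact ⟨max M N, mul_mem (mono (le_max_left M N) hM) (mono (le_max_right M N) hN)⟩
  | smul r b _ ihb =>
    obtain ⟨N, hN⟩ := ihb
    exact ⟨N, SMulMemClass.smul_mem r hN⟩

theorem exists_forall_mem_adjoin_image_Iic (s : Finset (commutatorAlgebra x a)) :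
    ∃ N, ∀ b ∈ s, (b : Module.End K V) ∈
      NonUnitalAlgebra.adjoin K (iteratedCommutator x a '' Set.Iic N) := by
  choose N hN using fun b : commutatorAlgebra x a => exists_mem_adjoin_image_Iic b.2
  exact ⟨s.sup N, fun b hb => NonUnitalAlgebra.adjoin_mono
    (Set.image_mono (Set.Iic_subset_Iic.2 (Finset.le_sup hb))) (hN b)⟩

/-- Finitely many elements involve only finitely many of the iterated commutators. -/
theorem isLocallyNilpotentAlgebra_of_killed_eq_top
    (h : ∀ N, ∃ M, killed (iteratedCommutator x a '' Set.Iic N) M = ⊤) :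
    IsLocallyNilpotentAlgebra K (commutatorAlgebra x a) := by
  intro s
  obtain ⟨N, hN⟩ := exists_forall_mem_adjoin_image_Iic s
  obtain ⟨M, hM⟩ := h N
  refine isNilpotentAlgebra_of_killed_eq_top
    (fun b => ((b : commutatorAlgebra x a) : Module.End K V)) (fun _ _ => rfl)
    (fun b hb => Subtype.ext (Subtype.ext hb)) (fun b => ?_) hM
  have hle : NonUnitalAlgebra.adjoin K (s : Set (commutatorAlgebra x a)) ≤
      (NonUnitalAlgebra.adjoin K (iteratedCommutator x a '' Set.Iic N)).comap
        (NonUnitalSubalgebraClass.subtype (commutatorAlgebra x a)) :=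
    NonUnitalAlgebra.adjoin_le fun b hb => hN b hb
  exact hle b.2

theorem commutator_mem {b : Module.End K V} (hb : b ∈ commutatorAlgebra x a) :
    x * b - b * x ∈ commutatorAlgebra x a := by
  induction hb using NonUnitalAlgebra.adjoin_induction with
  | mem b hb =>
    obtain ⟨i, rfl⟩ := hb
    exact iteratedCommutator_mem (i + 1)
  | add b c _ _ ihb ihc =>
    rw [show x * (b + c) - (b + c) * x = (x * b - b * x) + (x * c - c * x) by
      noncomm_ring]
    exact add_mem ihb ihc
  | zero => simp
  | mul b c hb hc ihb ihc =>
    rw [show x * (b * c) - b * c * x = (x * b - b * x) * c + b * (x * c - c * x) by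
      simp only [mul_sub, sub_mul, mul_assoc, sub_add_sub_cancel]]
    exact add_mem (mul_mem ihb hc) (mul_mem hb ihc)
  | smul r b _ ihb =>
    rw [mul_smul_comm, smul_mul_assoc, ← smul_sub]
    exact SMulMemClass.smul_mem r ihb

variable (x a) in
/-- The derivation given by the commutator with `x`. -/
def commutatorDerivation : NUDerivation K (commutatorAlgebra x a) where
  toFun b := ⟨x * b - b * x, commutator_mem b.2⟩
  map_add' b c := Subtype.ext (by
    change x * (b + c) - (b + c) * x = (x * b - b * x) + (x * c - c * x)
    noncomm_ring)
  map_smul' r b := Subtype.ext (by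
    change x * (r • (b : Module.End K V)) - (r • (b : Module.End K V)) * x =
      r • (x * b - b * x)
    rw [mul_smul_comm, smul_mul_assoc, smul_sub])
  leibniz' b c := Subtype.ext (by
    change x * (b * c) - b * c * x = (x * b - b * x) * c + b * (x * c - c * x)
    simp only [mul_sub, sub_mul, mul_assoc, sub_add_sub_cancel])

/-- If `R[X; D]` is Jacobson radical, then `1 + x * a` is surjective. -/
theorem exists_add_mul_apply_eq (h : IsJacobsonRadicalRing (DiffPoly (commutatorDerivation x a)))
    (e : V) : ∃ v, v + (x * a) v = e := by
  set D := commutatorDerivation x a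
  set b : commutatorAlgebra x a := ⟨a, iteratedCommutator_mem 0⟩
  let ρ : commutatorAlgebra x a →+ Module.End K V :=
    (NonUnitalSubalgebraClass.subtype (commutatorAlgebra x a) :
      commutatorAlgebra x a →+ Module.End K V)
  have hmul : ∀ b c, ρ (b * c) = ρ b * ρ c := fun _ _ => rfl
  have hD : ∀ b, ρ (D.toLinearMap b) = x * ρ b - ρ b * x := fun _ => rfl
  -- This is the product `X b`, which lies in `R[X; D]` although `X` does not.
  set f : DiffPoly D := DiffPoly.monomial D 1 b + DiffPoly.monomial D 0 (D.toLinearMap b) with hf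
  obtain ⟨y, hy, -⟩ := isQuasiregular_iff.1 (h f)
  have hfx : DiffPoly.eval D ρ x f = x * a := by
    have ha : ρ b = a := rfl
    rw [hf, map_add, DiffPoly.eval_monomial, DiffPoly.eval_monomial, hD, ha, pow_one, pow_zero,
      mul_one, add_sub_cancel]
  have hfy : DiffPoly.eval D ρ x (f * y) = DiffPoly.eval D ρ x f * DiffPoly.eval D ρ x y := by
    rw [hf, add_mul, map_add, map_add, add_mul, DiffPoly.eval_monomial_mul D ρ _ hmul hD,
      DiffPoly.eval_monomial_mul D ρ _ hmul hD, DiffPoly.eval_monomial, DiffPoly.eval_monomial]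
  have hy' := congrArg (DiffPoly.eval D ρ x) hy
  rw [map_add, map_add, hfy, hfx, map_zero] at hy'
  -- `1 + y` is a right inverse of `1 + f`, so the preimage is `(1 + y) e`.
  refine ⟨e + DiffPoly.eval D ρ x y e, ?_⟩
  have hz : DiffPoly.eval D ρ x y e + (x * a) e + (x * a) (DiffPoly.eval D ρ x y e) = 0 :=
    LinearMap.congr_fun hy' e
  rw [map_add, add_assoc, ← add_assoc (DiffPoly.eval D ρ x y e), hz, add_zero]

theorem exists_locallyNilpotent_not_isJacobsonRadicalRing (x a : Module.End K V)
    (h : ∀ N, ∃ M, killed (iteratedCommutator x a '' Set.Iic N) M = ⊤)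
    (e : V) (he : ∀ v, v + (x * a) v ≠ e) :
    ∃ (R : Type u) (_ : NonUnitalRing R) (_ : Module K R) (_ : IsScalarTower K R R)
      (_ : SMulCommClass K R R) (D : NUDerivation K R),
      IsLocallyNilpotentAlgebra K R ∧ ¬ IsJacobsonRadicalRing (DiffPoly D) :=
  ⟨commutatorAlgebra x a, inferInstance, inferInstance, inferInstance, inferInstance,
    commutatorDerivation x a, isLocallyNilpotentAlgebra_of_killed_eq_top h,
    fun hJ => (exists_add_mul_apply_eq hJ e).elim he⟩

end Commutator

/-! ### The operators -/

namespace Odometer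

variable (K : Type u) [Field K]

/-- The space with basis the pairs `(k, m)` of a time `k` and exponents `m` of the variables
`T 0, T 1, …`. -/
abbrev Space : Type u := (ℕ × (ℕ → ℕ)) →₀ K

/-- The variables that are active at time `k`. -/
def active (k : ℕ) : Finset ℕ := (Finset.range (k + 1)).filter fun l => ¬ (l + 1)! ∣ k

/-- Every exponent belonging to a variable whose period ends at time `k` is full. -/
def IsFull (k : ℕ) (m : ℕ → ℕ) : Prop := ∀ l, (l + 1)! ∣ k → m l = l

/-- Erase the exponents of the variables whose period ends at time `k`. -/
def reset (k : ℕ) (m : ℕ → ℕ) : ℕ → ℕ := fun l => if (l + 1)! ∣ k then 0 else m l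

/-- Multiplication by the variable `T r`. -/
def var (r : ℕ) : Module.End K (Space K) :=
  Finsupp.linearCombination K fun p => Finsupp.single (p.1, p.2 + Pi.single r 1) 1

/-- Multiplication by the sum of the active variables. -/
def X : Module.End K (Space K) :=
  Finsupp.linearCombination K fun p =>
    ∑ l ∈ active p.1, Finsupp.single (p.1, p.2 + Pi.single l 1) 1

open Classical in
/-- The passage from time `k` to time `k + 1`: the top coefficient with respect to the variables
whose period ends at time `k + 1`. -/
def step : Module.End K (Space K) :=
  Finsupp.linearCombination K fun p =>
    if IsFull (p.1 + 1) p.2 then Finsupp.single (p.1 + 1, reset (p.1 + 1) p.2) 1 else 0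

variable {K}

theorem mem_active {l k : ℕ} : l ∈ active k ↔ l ≤ k ∧ ¬ (l + 1)! ∣ k := by
  simp [active]

theorem var_single (r k : ℕ) (m : ℕ → ℕ) :
    var K r (Finsupp.single (k, m) 1) = Finsupp.single (k, m + Pi.single r 1) 1 := by
  simp [var]

theorem X_single (k : ℕ) (m : ℕ → ℕ) :
    X K (Finsupp.single (k, m) 1) =
      ∑ l ∈ active k, Finsupp.single (k, m + Pi.single l 1) 1 := by
  simp [X]

theorem step_single_of_isFull {k : ℕ} {m : ℕ → ℕ} (h : IsFull (k + 1) m) :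
    step K (Finsupp.single (k, m) 1) = Finsupp.single (k + 1, reset (k + 1) m) 1 := by
  simp [step, h]

theorem step_single_of_not_isFull {k : ℕ} {m : ℕ → ℕ} (h : ¬ IsFull (k + 1) m) :
    step K (Finsupp.single (k, m) 1) = 0 := by
  simp [step, h]

theorem supported_le_comap {s : Set (ℕ × (ℕ → ℕ))} {b : Module.End K (Space K)}
    {P : Submodule K (Space K)}
    (h : ∀ k m, (k, m) ∈ s → b (Finsupp.single (k, m) 1) ∈ P) :
    Finsupp.supported K K s ≤ P.comap b := by
  rw [Finsupp.supported_eq_span_single, Submodule.span_le]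
  rintro _ ⟨⟨k, m⟩, hp, rfl⟩
  exact h k m hp

theorem end_ext {b c : Module.End K (Space K)}
    (h : ∀ k m, b (Finsupp.single (k, m) 1) = c (Finsupp.single (k, m) 1)) : b = c :=
  Finsupp.lhom_ext' fun p => LinearMap.ext_ring (h p.1 p.2)

theorem var_mul_X (r : ℕ) : var K r * X K = X K * var K r := by
  refine end_ext fun k m => ?_
  simp only [Module.End.mul_apply, X_single, var_single, map_sum, add_right_comm]

/-! ### Degree in a single variable under `X` and `step` -/

/-- The vectors at time `k`. -/
def row (K : Type u) [Field K] (k : ℕ) : Submodule K (Space K) :=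
  Finsupp.supported K K {p | p.1 = k}

/-- The vectors at time `k` of degree at most `e` in the variable `T r`. -/
def level (K : Type u) [Field K] (r k e : ℕ) : Submodule K (Space K) :=
  Finsupp.supported K K {p | p.1 = k ∧ p.2 r ≤ e}

theorem level_mono (r k : ℕ) {e e' : ℕ} (h : e ≤ e') : level K r k e ≤ level K r k e' :=
  Finsupp.supported_mono fun _ hp => ⟨hp.1, hp.2.trans h⟩

theorem level_le_row (r k e : ℕ) : level K r k e ≤ row K k :=
  Finsupp.supported_mono fun _ hp => hp.1

theorem single_mem_row (k : ℕ) (m : ℕ → ℕ) : Finsupp.single (k, m) 1 ∈ row K k :=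
  Finsupp.single_mem_supported K 1 rfl

theorem single_mem_level {r k e : ℕ} {m : ℕ → ℕ} (h : m r ≤ e) :
    Finsupp.single (k, m) 1 ∈ level K r k e :=
  Finsupp.single_mem_supported K 1 ⟨rfl, h⟩

theorem X_row (k : ℕ) : row K k ≤ (row K k).comap (X K) := by
  refine supported_le_comap fun k' m hk => ?_
  obtain rfl : k' = k := hk
  rw [X_single]
  exact sum_mem fun l _ => single_mem_row _ _

theorem step_row (k : ℕ) : row K k ≤ (row K (k + 1)).comap (step K) := by
  refine supported_le_comap fun k' m hk => ?_
  obtain rfl : k' = k := hk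
  by_cases h : IsFull (k' + 1) m
  · rw [step_single_of_isFull h]
    exact single_mem_row _ _
  · rw [step_single_of_not_isFull h]
    exact zero_mem _

theorem X_level (r k e : ℕ) : level K r k e ≤ (level K r k (e + 1)).comap (X K) := by
  refine supported_le_comap fun k' m hk => ?_
  obtain ⟨rfl : k' = k, hm : m r ≤ e⟩ := hk
  rw [X_single]
  refine sum_mem fun l _ => single_mem_level ?_
  rw [Pi.add_apply, Pi.single_apply]
  split_ifs <;> omega

theorem X_level_of_dvd {r k : ℕ} (e : ℕ) (h : (r + 1)! ∣ k) :
    level K r k e ≤ (level K r k e).comap (X K) := by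
  refine supported_le_comap fun k' m hk => ?_
  obtain ⟨rfl : k' = k, hm : m r ≤ e⟩ := hk
  rw [X_single]
  refine sum_mem fun l hl => single_mem_level ?_
  have hne : r ≠ l := by
    rintro rfl
    exact (mem_active.1 hl).2 h
  simpa [Pi.single_eq_of_ne hne] using hm

theorem X_sub_var_level {r k : ℕ} (e : ℕ) (h : r ∈ active k) :
    level K r k e ≤ (level K r k e).comap (X K - var K r) := by
  refine supported_le_comap fun k' m hk => ?_
  obtain ⟨rfl : k' = k, hm : m r ≤ e⟩ := hk
  rw [LinearMap.sub_apply, X_single, var_single, ← Finset.add_sum_erase _ _ h,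
    add_sub_cancel_left]
  refine sum_mem fun l hl => single_mem_level ?_
  simpa [Pi.single_eq_of_ne (Finset.ne_of_mem_erase hl).symm] using hm

theorem step_level (r k e : ℕ) : level K r k e ≤ (level K r (k + 1) e).comap (step K) := by
  refine supported_le_comap fun k' m hk => ?_
  obtain ⟨rfl : k' = k, hm : m r ≤ e⟩ := hk
  by_cases h : IsFull (k' + 1) m
  · rw [step_single_of_isFull h]
    refine single_mem_level ?_
    rw [reset]
    split_ifs <;> omega
  · rw [step_single_of_not_isFull h]
    exact zero_mem _

theorem step_row_of_dvd {r k : ℕ} (h : (r + 1)! ∣ k + 1) :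
    row K k ≤ (level K r (k + 1) 0).comap (step K) := by
  refine supported_le_comap fun k' m hk => ?_
  obtain rfl : k' = k := hk
  by_cases hf : IsFull (k' + 1) m
  · rw [step_single_of_isFull hf]
    exact single_mem_level (by simp [reset, h])
  · rw [step_single_of_not_isFull hf]
    exact zero_mem _

theorem step_level_of_dvd {r k e : ℕ} (h : (r + 1)! ∣ k + 1) (he : e < r) :
    level K r k e ≤ (⊥ : Submodule K (Space K)).comap (step K) := by
  refine supported_le_comap fun k' m hk => ?_
  obtain ⟨rfl : k' = k, hm : m r ≤ e⟩ := hk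
  rw [step_single_of_not_isFull fun hf => by have := hf r h; omega]
  exact zero_mem _

/-- Away from a period end of `T r`, its exponent is neither tested nor erased. -/
theorem step_var {r k : ℕ} (h : ¬ (r + 1)! ∣ k + 1) :
    ∀ w ∈ row K k, step K (var K r w) = var K r (step K w) := by
  have key : row K k ≤ (⊥ : Submodule K (Space K)).comap
      (step K * var K r - var K r * step K) := by
    refine supported_le_comap fun k' m hk => ?_
    obtain rfl : k' = k := hk
    rw [Submodule.mem_bot, LinearMap.sub_apply, sub_eq_zero, Module.End.mul_apply,
      Module.End.mul_apply, var_single]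
    have hne : ∀ l, (l + 1)! ∣ k' + 1 → (m + Pi.single r 1 : ℕ → ℕ) l = m l := by
      intro l hl
      have : l ≠ r := by
        rintro rfl
        exact h hl
      simp [Pi.single_eq_of_ne this]
    by_cases hf : IsFull (k' + 1) m
    · have hf' : IsFull (k' + 1) (m + Pi.single r 1) :=
        fun l hl => (hne l hl).trans (hf l hl)
      rw [step_single_of_isFull hf, step_single_of_isFull hf', var_single]
      congr 2
      funext l
      simp only [reset, Pi.add_apply]
      by_cases hl : (l + 1)! ∣ k' + 1
      · have : l ≠ r := by
          rintro rfl
          exact h hl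
        simp [hl, this]
      · simp [hl]
    · have hf' : ¬ IsFull (k' + 1) (m + Pi.single r 1) :=
        fun hf' => hf fun l hl => (hne l hl).symm.trans (hf' l hl)
      rw [step_single_of_not_isFull hf, step_single_of_not_isFull hf', map_zero]
  intro w hw
  exact sub_eq_zero.1 ((Submodule.mem_bot K).1 (key hw))

/-! ### The iterated commutators -/

variable (K) in
/-- The iterated commutators `[X, [X, …, [X, step]]]`. -/
abbrev gen : ℕ → Module.End K (Space K) := iteratedCommutator (X K) (step K)

theorem gen_succ_apply (i : ℕ) (w : Space K) :
    gen K (i + 1) w = X K (gen K i w) - gen K i (X K w) := rfl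

theorem gen_row (i k : ℕ) : ∀ w ∈ row K k, gen K i w ∈ row K (k + 1) := by
  induction i with
  | zero => exact step_row k
  | succ i ih =>
    exact fun w hw => sub_mem (X_row _ (ih w hw)) (ih _ (X_row k hw))

/-- Factors `X` applied before `step` are harmless since `step` erases `T r`; those applied after it
do not involve `T r`, which is inactive at time `k + 1`. -/
theorem gen_row_of_dvd {r k : ℕ} (h : (r + 1)! ∣ k + 1) (i : ℕ) :
    ∀ w ∈ row K k, gen K i w ∈ level K r (k + 1) 0 := by
  induction i with
  | zero => exact step_row_of_dvd h
  | succ i ih =>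
    exact fun w hw => sub_mem (X_level_of_dvd 0 h (ih w hw)) (ih _ (X_row k hw))

/-- `T r` is inactive at time `k`, so only the at most `i` factors `X` applied after `step` can
raise the degree. -/
theorem gen_level_of_dvd_left {r k : ℕ} (h : (r + 1)! ∣ k) (e i : ℕ) :
    ∀ w ∈ level K r k e, gen K i w ∈ level K r (k + 1) (e + i) := by
  induction i with
  | zero => exact step_level r k e
  | succ i ih =>
    exact fun w hw => sub_mem (X_level _ _ _ (ih w hw))
      (level_mono r _ (Nat.le_succ _) (ih _ (X_level_of_dvd e h hw)))

theorem gen_level_of_dvd_right {r k : ℕ} (h : (r + 1)! ∣ k + 1) (i : ℕ) :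
    ∀ e, e + i < r → ∀ w ∈ level K r k e, gen K i w = 0 := by
  induction i with
  | zero =>
    exact fun e he w hw => (Submodule.mem_bot K).1 (step_level_of_dvd h he hw)
  | succ i ih =>
    intro e he w hw
    rw [gen_succ_apply, ih e (by omega) w hw,
      ih (e + 1) (by omega) _ (X_level r k e hw), map_zero, sub_zero]

theorem gen_var {r k : ℕ} (h : ¬ (r + 1)! ∣ k + 1) (i : ℕ) :
    ∀ w ∈ row K k, gen K i (var K r w) = var K r (gen K i w) := by
  have hX : ∀ w, X K (var K r w) = var K r (X K w) :=
    fun w => (LinearMap.congr_fun (var_mul_X r) w).symm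
  induction i with
  | zero => exact step_var h
  | succ i ih =>
    intro w hw
    rw [gen_succ_apply, gen_succ_apply, ih w hw, hX, hX, ih _ (X_row k hw), map_sub]

/-- As `gen K i` commutes with `var K r` here, the commutator with `X` equals the one with `X - var
K r`, which does not involve `T r`. This keeps the bound independent of `i`. -/
theorem gen_level_of_active {r k : ℕ} (h : r ∈ active k) (h' : r ∈ active (k + 1)) (e i : ℕ) :
    ∀ w ∈ level K r k e, gen K i w ∈ level K r (k + 1) e := by
  induction i with
  | zero => exact step_level r k e
  | succ i ih =>
    intro w hw
    have hv := gen_var (K := K) (mem_active.1 h').2 i w (level_le_row r k e hw)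
    have : gen K (i + 1) w =
        (X K - var K r) (gen K i w) - gen K i ((X K - var K r) w) := by
      rw [gen_succ_apply, LinearMap.sub_apply, LinearMap.sub_apply, map_sub, hv]
      abel
    rw [this]
    exact sub_mem (X_sub_var_level e h' (ih w hw)) (ih _ (X_sub_var_level e h hw))

/-! ### Local nilpotency -/

variable (K) in
/-- The first `N + 1` iterated commutators. -/
def genSet (N : ℕ) : Set (Module.End K (Space K)) := gen K '' Set.Iic N

theorem le_killed_succ {N n : ℕ} {P Q : Submodule K (Space K)} (hQ : Q ≤ killed (genSet K N) n)
    (h : ∀ i ≤ N, ∀ w ∈ P, gen K i w ∈ Q) : P ≤ killed (genSet K N) (n + 1) := by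
  intro w hw
  rw [mem_killed_succ]
  rintro _ ⟨i, hi, rfl⟩
  exact hQ (h i hi w hw)

/-- Induction backwards from the period end `k + (2 * N + 2)!`. Positivity of `k` guarantees that
the time has passed the cutoff `l ≤ k` in `active`. -/
theorem level_le_killed {N k : ℕ} (hk : 0 < k) (hd : (2 * N + 2)! ∣ k) (n : ℕ)
    (hn : n + 1 < (2 * N + 2)!) :
    level K (2 * N + 1) (k + (2 * N + 2)! - (n + 1)) N ≤ killed (genSet K N) (n + 1) := by
  have hle := Nat.le_of_dvd hk hd
  have hself := Nat.self_le_factorial (2 * N + 2)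
  have hact : ∀ j, 0 < j → j < (2 * N + 2)! → 2 * N + 1 ∈ active (k + (2 * N + 2)! - j) := by
    intro j hj hj'
    refine mem_active.2 ⟨by omega, fun hdvd => ?_⟩
    have h2 : (2 * N + 2)! ∣ k + (2 * N + 2)! - (k + (2 * N + 2)! - j) :=
      Nat.dvd_sub (hd.add dvd_rfl) hdvd
    have := Nat.le_of_dvd (by omega) h2
    omega
  induction n with
  | zero =>
    refine le_killed_succ (Q := ⊥) bot_le fun i hi w hw => ?_
    refine (Submodule.mem_bot K).2
      (gen_level_of_dvd_right (r := 2 * N + 1) ?_ i N (by omega) w hw)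
    rw [Nat.sub_add_cancel (by omega)]
    exact hd.add dvd_rfl
  | succ n ih =>
    refine le_killed_succ (ih (by omega)) fun i hi w hw => ?_
    have hs : k + (2 * N + 2)! - (n + 1) = k + (2 * N + 2)! - (n + 1 + 1) + 1 := by omega
    have h2 := hact (n + 1) (by omega) (by omega)
    rw [hs] at h2 ⊢
    exact gen_level_of_active (hact (n + 1 + 1) (by omega) (by omega)) h2 N i w hw

theorem row_le_killed {N k : ℕ} (hk : 0 < k) (hd : (2 * N + 2)! ∣ k) (n : ℕ) (hn : n < k) :
    row K (k - (n + 1)) ≤ killed (genSet K N) ((2 * N + 2)! + 1 + n) := by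
  have hself := Nat.self_le_factorial (2 * N + 2)
  induction n with
  | zero =>
    -- The generator leaving time `k` raises the degree from 0 to at most `N`; the remaining `(2 * N
    -- + 2)! - 1` generators complete the period.
    have h0 : level K (2 * N + 1) k 0 ≤ killed (genSet K N) (2 * N + 2)! := by
      have h1 : ∃ q, (2 * N + 2)! = q + 1 + 1 := ⟨(2 * N + 2)! - 2, by omega⟩
      obtain ⟨q, hq⟩ := h1
      have h2 := level_le_killed (K := K) hk hd q (by omega)
      rw [hq] at h2 ⊢
      refine le_killed_succ h2 fun i hi w hw => ?_
      have h3 := gen_level_of_dvd_left (r := 2 * N + 1) hd 0 i w hw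
      rw [show k + (q + 1 + 1) - (q + 1) = k + 1 by omega]
      exact level_mono _ _ (by omega) h3
    refine le_killed_succ h0 fun i hi w hw => ?_
    have h4 : k - (0 + 1) + 1 = k := by omega
    have h5 := gen_row_of_dvd (r := 2 * N + 1) (by rwa [h4]) i w hw
    rwa [h4] at h5
  | succ n ih =>
    refine le_killed_succ (ih (by omega)) fun i hi w hw => ?_
    have h6 := gen_row i _ w hw
    rwa [show k - (n + 1 + 1) + 1 = k - (n + 1) by omega] at h6

theorem killed_genSet_eq_top (N : ℕ) :
    killed (genSet K N) (2 * (2 * N + 2)!) = ⊤ := by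
  refine top_unique ?_
  rw [← Finsupp.supported_univ, Finsupp.supported_eq_span_single, Submodule.span_le]
  rintro _ ⟨⟨j, m⟩, -, rfl⟩
  set q := (2 * N + 2)! with hq
  have hpos : 0 < q := Nat.factorial_pos _
  have hmod := Nat.mod_lt j hpos
  have hdiv := Nat.div_add_mod j q
  have hk : q * (j / q + 1) = q * (j / q) + q := by ring
  -- The first multiple of `q` strictly after `j` is reached in at most `q` steps, and one full
  -- period then takes `q` more.
  have h := row_le_killed (K := K) (N := N) (k := q * (j / q + 1)) (by positivity)
    (dvd_mul_right _ _) (q - 1 - j % q) (by omega)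
  rw [show q * (j / q + 1) - (q - 1 - j % q + 1) = j by omega] at h
  exact killed_mono _ (by omega) (h (single_mem_row j m))

/-! ### The leading terms of the powers of `X * step` -/

/-- The digits of `k` in the factorial number system. -/
def digit (k l : ℕ) : ℕ := k / l ! % (l + 1)

theorem digit_of_dvd_succ {k l : ℕ} (h : (l + 1)! ∣ k + 1) : digit k l = l := by
  obtain ⟨t, ht⟩ := h
  have hpos := Nat.factorial_pos l
  have ht0 : t ≠ 0 := by
    rintro rfl
    simp at ht
  obtain ⟨t, rfl⟩ := Nat.exists_eq_succ_of_ne_zero ht0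
  -- Division of `k` by `l !` with remainder `l ! - 1`; the quotient is visibly `l` modulo `l + 1`.
  have hk : k = ((l !) - 1) + l ! * (l + (l + 1) * t) := by
    have : (l + 1)! * (t + 1) = l ! * (l + (l + 1) * t) + l ! := by
      rw [Nat.factorial_succ]; ring
    rw [Nat.succ_eq_add_one] at ht
    omega
  rw [digit, hk, Nat.add_mul_div_left _ _ hpos, Nat.div_eq_of_lt (by omega), zero_add,
    Nat.add_mul_mod_self_left, Nat.mod_eq_of_lt (Nat.lt_succ_self l)]

theorem digit_succ_of_dvd {k l : ℕ} (h : (l + 1)! ∣ k + 1) : digit (k + 1) l = 0 := by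
  obtain ⟨t, ht⟩ := h
  rw [digit, ht, Nat.factorial_succ, mul_comm (l + 1), mul_assoc,
    Nat.mul_div_cancel_left _ (Nat.factorial_pos l), Nat.mul_mod_right]

theorem digit_succ_of_not_dvd {k l : ℕ} (h : ¬ l ! ∣ k + 1) : digit (k + 1) l = digit k l := by
  rw [digit, digit, Nat.succ_div_of_not_dvd h]

theorem digit_succ_of_dvd_of_not_dvd {k l : ℕ} (h : l ! ∣ k + 1) (h' : ¬ (l + 1)! ∣ k + 1) :
    digit (k + 1) l = digit k l + 1 := by
  have hd : ¬ (l + 1) ∣ k / l ! + 1 := by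
    rw [← Nat.succ_div_of_dvd h]
    rintro ⟨t, ht⟩
    refine h' ⟨t, ?_⟩
    rw [← Nat.div_mul_cancel h, ht, Nat.factorial_succ]
    ring
  rw [digit, digit, Nat.succ_div_of_dvd h]
  rw [Nat.dvd_iff_mod_eq_zero] at hd
  have := Nat.mod_lt (k / l !) (show 0 < l + 1 by omega)
  rw [Nat.add_mod_eq_ite] at hd ⊢
  rcases Nat.eq_zero_or_pos l with rfl | hl
  · simp at h'
  · rw [Nat.mod_eq_of_lt (show 1 < l + 1 by omega)] at hd ⊢
    split_ifs at hd ⊢ <;> omega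

theorem exists_first_not_dvd (k : ℕ) :
    ∃ r, r ∈ active (k + 1) ∧ r ! ∣ k + 1 ∧ ∀ l < r, (l + 1)! ∣ k + 1 := by
  have hex : ∃ r, ¬ (r + 1)! ∣ k + 1 := ⟨k + 1, fun h => by
    have := Nat.le_of_dvd (Nat.succ_pos k) h
    have := Nat.self_le_factorial (k + 1 + 1)
    omega⟩
  classical
  refine ⟨Nat.find hex, ?_, ?_, fun l hl => not_not.1 (Nat.find_min hex hl)⟩
  · refine mem_active.2 ⟨?_, Nat.find_spec hex⟩
    -- Since `(k + 2)! > k + 1`, the first failure occurs at or before `k + 1`, within the cutoff of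
    -- `active (k + 1)`.
    refine Nat.find_min' hex fun h => ?_
    have := Nat.le_of_dvd (Nat.succ_pos k) h
    have := Nat.self_le_factorial (k + 1 + 1)
    omega
  · rcases Nat.eq_zero_or_pos (Nat.find hex) with h | h
    · simp [h]
    · have h2 := not_not.1 (Nat.find_min hex (Nat.sub_lt h Nat.one_pos))
      rwa [show Nat.find hex - 1 + 1 = Nat.find hex from Nat.sub_add_cancel h] at h2

/-- The odometer rule: the full digits below position `r` roll over to 0 and the carry lands at `r`.
-/
theorem digit_succ {k r : ℕ} (hr : r ∈ active (k + 1)) (hd : r ! ∣ k + 1)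
    (hlt : ∀ l < r, (l + 1)! ∣ k + 1) :
    digit (k + 1) = reset (k + 1) (digit k) + Pi.single r 1 := by
  funext l
  rw [Pi.add_apply, reset]
  rcases lt_trichotomy l r with h | rfl | h
  · simp [hlt l h, digit_succ_of_dvd (hlt l h), Pi.single_eq_of_ne h.ne]
  · rw [digit_succ_of_dvd_of_not_dvd hd (mem_active.1 hr).2, if_neg (mem_active.1 hr).2,
      Pi.single_eq_same]
  · have hn : ¬ l ! ∣ k + 1 := fun h2 =>
      (mem_active.1 hr).2 ((Nat.factorial_dvd_factorial h).trans h2)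
    have hn' : ¬ (l + 1)! ∣ k + 1 := fun h2 =>
      hn ((Nat.factorial_dvd_factorial (Nat.le_succ l)).trans h2)
    rw [digit_succ_of_not_dvd hn, if_neg hn', Pi.single_eq_of_ne h.ne', add_zero]

/-! ### Leading exponents, with lower indices more significant -/

/-- The lexicographic order on exponents. -/
def LexLT (m m' : ℕ → ℕ) : Prop := ∃ j, (∀ l < j, m l = m' l) ∧ m j < m' j

variable (K) in
/-- The vectors at time `k` all of whose exponents lie below the digits of `k`. -/
def lower (k : ℕ) : Submodule K (Space K) :=
  Finsupp.supported K K {p | p.1 = k ∧ LexLT p.2 (digit k)}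

theorem lexLT_add_single {m m' : ℕ → ℕ} {r l : ℕ} (hrl : r < l) (h : ∀ i < r, m i = m' i)
    (hr : m r ≤ m' r) : LexLT (m + Pi.single l 1) (m' + Pi.single r 1) := by
  refine ⟨r, fun i hi => ?_, ?_⟩
  · simp [Pi.single_eq_of_ne hi.ne, Pi.single_eq_of_ne (hi.trans hrl).ne, h i hi]
  · simpa [Pi.single_eq_of_ne hrl.ne] using Nat.lt_succ_of_le hr

theorem LexLT.add_right {m m' : ℕ → ℕ} (h : LexLT m m') (n : ℕ → ℕ) :
    LexLT (m + n) (m' + n) := by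
  obtain ⟨j, hj, hlt⟩ := h
  exact ⟨j, fun l hl => by simp [hj l hl], by simpa using hlt⟩

/-- A lower monomial is either killed by `step` or first falls below the digits at a position that
is not erased, so it stays lower after the reset. Among the active variables the one of least index
`r`, the carry position, gives the largest product. -/
theorem X_step_lower (k : ℕ) : lower K k ≤ (lower K (k + 1)).comap (X K * step K) := by
  refine supported_le_comap fun k' m hk => ?_
  obtain ⟨rfl : k' = k, j, hj, hlt⟩ := hk
  dsimp only at hj hlt
  rw [Module.End.mul_apply]
  by_cases hf : IsFull (k' + 1) m
  · obtain ⟨r, hr, hd, hmin⟩ := exists_first_not_dvd k'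
    -- If `T j` were erased, both exponents at `j` would equal `j`, contradicting `m j < digit k'
    -- j`.
    have hjn : ¬ (j + 1)! ∣ k' + 1 := fun h => by
      have h1 := hf j h
      have h2 := digit_of_dvd_succ h
      omega
    have hlex : LexLT (reset (k' + 1) m) (reset (k' + 1) (digit k')) :=
      ⟨j, fun l hl => by simp [reset, hj l hl], by simpa [reset, hjn] using hlt⟩
    have hrj : r ≤ j := not_lt.1 fun h => hjn (hmin j h)
    rw [step_single_of_isFull hf, X_single]
    refine sum_mem fun l hl => Finsupp.single_mem_supported K 1 ⟨rfl, ?_⟩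
    rw [digit_succ hr hd hmin]
    have hrl : r ≤ l := not_lt.1 fun h => (mem_active.1 hl).2 (hmin l h)
    rcases hrl.eq_or_lt with rfl | hrl
    · exact hlex.add_right _
    · refine lexLT_add_single hrl (fun i hi => by simp [reset, hmin i hi]) ?_
      have : m r ≤ digit k' r := by
        rcases hrj.eq_or_lt with rfl | h
        · exact hlt.le
        · exact (hj r h).le
      simpa [reset, (mem_active.1 hr).2] using this
  · rw [step_single_of_not_isFull hf, map_zero]
    exact zero_mem _

theorem X_step_digit (k : ℕ) :
    (X K * step K) (Finsupp.single (k, digit k) 1) -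
      Finsupp.single (k + 1, digit (k + 1)) 1 ∈ lower K (k + 1) := by
  obtain ⟨r, hr, hd, hmin⟩ := exists_first_not_dvd k
  rw [Module.End.mul_apply, step_single_of_isFull fun l hl => digit_of_dvd_succ hl, X_single,
    ← Finset.add_sum_erase _ _ hr, ← digit_succ hr hd hmin, add_sub_cancel_left]
  refine sum_mem fun l hl => Finsupp.single_mem_supported K 1 ⟨rfl, ?_⟩
  rw [Finset.mem_erase] at hl
  have hrl : r < l := lt_of_le_of_ne
    (not_lt.1 fun h => (mem_active.1 hl.2).2 (hmin l h)) hl.1.symm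
  rw [digit_succ hr hd hmin]
  exact lexLT_add_single hrl (fun _ _ => rfl) le_rfl

theorem X_step_pow_sub_mem_lower (k : ℕ) :
    ((X K * step K) ^ k) (Finsupp.single (0, digit 0) 1) - Finsupp.single (k, digit k) 1 ∈
      lower K k := by
  induction k with
  | zero => simp
  | succ k ih =>
    have h := add_mem (Submodule.mem_comap.1 (X_step_lower k ih)) (X_step_digit k)
    rwa [map_sub, sub_add_sub_cancel, ← Module.End.mul_apply, ← pow_succ'] at h

theorem X_step_pow_apply (k : ℕ) :
    ((X K * step K) ^ k) (Finsupp.single (0, digit 0) 1) (k, digit k) = 1 := by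
  have hn : ¬ LexLT (digit k) (digit k) := fun ⟨_, _, h⟩ => lt_irrefl _ h
  have h := (Finsupp.mem_supported' K _).1 (X_step_pow_sub_mem_lower (K := K) k) (k, digit k)
    fun h => hn h.2
  rw [Finsupp.sub_apply, Finsupp.single_eq_same] at h
  exact sub_eq_zero.1 h

/-! ### Failure of surjectivity -/

theorem X_step_le_comap (n : ℕ) :
    Finsupp.supported K K {p : ℕ × (ℕ → ℕ) | n ≤ p.1} ≤
      (Finsupp.supported K K {p : ℕ × (ℕ → ℕ) | n + 1 ≤ p.1}).comap (X K * step K) := by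
  refine supported_le_comap fun k m hk => ?_
  have h := X_row (K := K) _ (step_row (K := K) k (single_mem_row k m))
  exact Finsupp.supported_mono
    (fun p hp => by rw [Set.mem_ofPred_eq] at hp hk ⊢; omega) h

theorem not_exists_X_step (v : Space K) :
    v + (X K * step K) v ≠ Finsupp.single (0, digit 0) 1 := by
  intro hv
  set f := X K * step K
  set e : Space K := Finsupp.single (0, digit 0) 1
  -- Iteration of `v = e - f v`. The remainder lives at times at least `n` and `(f ^ i) e` at time
  -- `i`, so the coefficient of `v` at `(k, digit k)` comes from `i = k` alone and is `(-1) ^ k`.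
  have expand : ∀ n, v = ∑ i ∈ Finset.range n, ((-1 : K) ^ i) • (f ^ i) e +
      ((-1 : K) ^ n) • (f ^ n) v := by
    intro n
    induction n with
    | zero => simp
    | succ n ih =>
      have h2 : (f ^ n) v = (f ^ n) e - (f ^ (n + 1)) v := by
        rw [← hv, map_add, ← Module.End.mul_apply, ← pow_succ, add_sub_cancel_right]
      rw [h2] at ih
      conv_lhs => rw [ih]
      rw [Finset.sum_range_succ, smul_sub, pow_succ (-1 : K)]
      module
  have high : ∀ n, (f ^ n) v ∈ Finsupp.supported K K {p : ℕ × (ℕ → ℕ) | n ≤ p.1} := by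
    intro n
    induction n with
    | zero => simp [Finsupp.supported_univ]
    | succ n ih =>
      rw [pow_succ']
      exact X_step_le_comap n ih
  have exact_row : ∀ i, (f ^ i) e ∈ row K i := by
    intro i
    induction i with
    | zero => exact single_mem_row _ _
    | succ i ih =>
      rw [pow_succ']
      exact X_row _ (step_row i ih)
  have coeff : ∀ k, v (k, digit k) ≠ 0 := by
    intro k
    rw [expand (k + 1), Finsupp.add_apply, Finsupp.smul_apply,
      (Finsupp.mem_supported' K _).1 (high (k + 1)) (k, digit k)
        (by simp), smul_zero, add_zero, Finsupp.finsetSum_apply,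
      Finset.sum_eq_single k]
    · rw [Finsupp.smul_apply, X_step_pow_apply]
      simp
    · intro i _ hik
      rw [Finsupp.smul_apply,
        (Finsupp.mem_supported' K _).1 (exact_row i) (k, digit k) fun h => hik h.symm, smul_zero]
    · simp
  have hinj : Function.Injective fun k : ℕ => (k, digit k) :=
    fun _ _ h => congrArg Prod.fst h
  exact (Set.infinite_range_of_injective hinj) (v.support.finite_toSet.subset (by
    rintro _ ⟨k, rfl⟩
    exact Finsupp.mem_support_iff.2 (coeff k)))

end Odometer

end

theorem mainTheorem2 (K : Type u) [Field K] :
    ∃ (R : Type u) (_ : NonUnitalRing R) (_ : Module K R) (_ : IsScalarTower K R R)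
      (_ : SMulCommClass K R R) (D : NUDerivation K R),
      IsLocallyNilpotentAlgebra K R ∧ ¬ IsJacobsonRadicalRing (DiffPoly D) :=
  exists_locallyNilpotent_not_isJacobsonRadicalRing (Odometer.X K) (Odometer.step K)
    (fun N => ⟨_, Odometer.killed_genSet_eq_top N⟩) _ Odometer.not_exists_X_step
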